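/- Let $S$ be a locally compact second countable (Hausdorff) group and $\Gamma<S$ a closed subgroup. Endow $S/\Gamma$ with its canonical $S$-invariant measure class, in which a set is null if and only if its preimage in $S$ is Haar-null. Assume that there is a finite or infinite sequence of abelian subgroups $T_0,T_1,\ldots<S$ (with the subspace topology) which together topologically generate $S$, such that for every $i>0$ every element of $T_i$ commutes with every element of $T_{i-1}$, and for every $i\ge 0$ the group $T_i$ acts ergodically on $S/\Gamma$, i.e. every measurable set $A\subset S/\Gamma$ such that $tA=A$ up to null sets for all $t\in T_i$ is null or conull. Let $N$ be the closed normal subgroup of $S$ generated by $\Gamma$, and assume that $S/N$ has trivial abelianization as a topological group, i.e. the commutator subgroup of $S/N$ is dense in $S/N$. Then for every $i$ the $T_i$-space $S/\Gamma$ has only trivial proper representations. That is: for every Polish group $G$, every continuous homomorphism $\theta:T_i\to G$, every Polish space $V$ with an action of $G$ such that the map $G\times V\to V\times V$, $(g,v)\mapsto(v,gv)$, is continuous and proper, and every almost everywhere defined measurable map $\phi:S/\Gamma\to V$ such that for every $t\in T_i$ one has $\phi(tx)=\theta(t)\phi(x)$ for almost every $x\in S/\Gamma$, the map $\phi$ is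 essentially constant. -/

import Mathlib

open MeasureTheory Filter Topology

universe u v w

/-- A measure on `S ⧸ Γ` representing the canonical invariant measure class: a set is null iff its
preimage in `S` is null for Haar measure. Only its null sets are used. -/
noncomputable def cosetHaar {S : Type u} [Group S] [TopologicalSpace S] [IsTopologicalGroup S]
    [LocallyCompactSpace S] [MeasurableSpace S] [BorelSpace S] (Γ : Subgroup S) :
    Measure (S ⧸ Γ) :=
  Measure.map (fun s : S => (s : S ⧸ Γ)) Measure.haar

/-- Ergodicity of an action with respect to (the measure class of) `μ`: every measurable set that is
invariant up to null sets is null or conull. No invariant measure is required. -/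
def IsErgodicAction (T : Type*) {X : Type*} [Group T] [MulAction T X] [MeasurableSpace X]
    (μ : Measure X) : Prop :=
  ∀ A : Set X, MeasurableSet A → (∀ t : T, (fun x => t • x) ⁻¹' A =ᵐ[μ] A) →
    μ A = 0 ∨ μ Aᶜ = 0

/-- The `T`-space `(X, μ)` has only trivial proper representations: for every Polish group `G`,
continuous homomorphism `θ : T → G`, proper Polish `G`-space `V`, each almost everywhere defined
measurable `T`-equivariant map `φ : X → V` is essentially constant.
(`ProperSMul G V` says that `(g, v) ↦ (g • v, v)` is continuous and proper.) -/
def OnlyTrivialProperReps (T : Type u) {X : Type u} [Group T] [TopologicalSpace T] [MulAction T X]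
    [MeasurableSpace X] (μ : Measure X) : Prop :=
  ∀ (G : Type v) [Group G] [TopologicalSpace G] [IsTopologicalGroup G] [PolishSpace G]
    (θ : T →* G), Continuous θ →
  ∀ (V : Type w) [TopologicalSpace V] [PolishSpace V] [MeasurableSpace V] [BorelSpace V]
    [MulAction G V] [ProperSMul G V] (φ : X → V), AEMeasurable φ μ →
    (∀ t : T, ∀ᵐ x ∂μ, φ (t • x) = θ t • φ x) →
    ∃ v : V, ∀ᵐ x ∂μ, φ x = v

/-- The closed normal subgroup of `S` generated by `Γ`. -/
def closedNormalClosure {S : Type u} [Group S] [TopologicalSpace S] [IsTopologicalGroup S]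
    (Γ : Subgroup S) : Subgroup S :=
  (Subgroup.normalClosure (Γ : Set S)).topologicalClosure

instance closedNormalClosure_normal {S : Type u} [Group S] [TopologicalSpace S]
    [IsTopologicalGroup S] (Γ : Subgroup S) : (closedNormalClosure Γ).Normal :=
  Subgroup.is_normal_topologicalClosure _

/-!
Let `φ : S ⧸ Γ → V` be equivariant along `θ : T i → G`. The closure `B` of the range of `θ` is
abelian and acts properly on `V`, so the orbit space of `B` is Hausdorff and second countable, and
ergodicity of `T i` confines `φ` to one orbit (`exists_ae_mem_orbit`). This orbit is homeomorphic to
the abelian group `A = B ⧸ stabilizer` (`isClosedEmbedding_ofQuotientStabilizer`), so `φ` becomes a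
map to `A` on which every `t ∈ T i` acts through multiplication by a constant.

If `s` commutes with `T i`, then `x ↦ (φ x)⁻¹ * φ (s x)` is `T i`-invariant, hence constant, so `s`
multiplies `φ` by a constant as well (`exists_ae_eq_mul_const_of_commute`). This passes from `T i` to
its neighbours in the sequence, then to all of them, hence to a dense subgroup `H` of `S`.

Lift `φ` to `Φ : S → A`. The same principle is applied once more, now to left translations by `H`,
which are ergodic on `S` because `H` is dense, and to right translations, which commute with them:
for every `y : S` there is a constant `d y` with `Φ (x * y) = Φ x * d y` for almost every `x`. The
map `d : S → A` is a homomorphism to an abelian group, and it is trivial on `Γ` since `Φ` is right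
`Γ`-invariant. The assumption on `S ⧸ N` therefore makes the kernel of `d` dense, whether or not `d`
is continuous (`dense_ker_of_subsingleton_topologicalAbelianization`). As `Φ` is invariant under
right translation by this dense subgroup, it is essentially constant
(`ae_eq_const_of_dense_leftQuasiStabilizer`).
-/

/-! ### Ergodicity and essentially constant maps -/

section Ergodicity

variable {X Y ι : Type*} [MeasurableSpace X] {μ : Measure X}

/-- Under an ergodic family of maps, every invariant map into a second countable `T₀` space is
essentially constant, as its values are determined by countably many open sets. No σ-algebra on the
target is involved, so that the lemma applies to orbit spaces. -/
theorem exists_ae_eq_const_of_invariant [TopologicalSpace Y] [SecondCountableTopology Y]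
    [T0Space Y] [Nonempty Y] (g : ι → X → X)
    (herg : ∀ A : Set X, MeasurableSet A → (∀ t, g t ⁻¹' A =ᵐ[μ] A) → μ A = 0 ∨ μ Aᶜ = 0)
    {f : X → Y} (hf : ∀ U : Set Y, IsOpen U → MeasurableSet (f ⁻¹' U))
    (hinv : ∀ t, ∀ᵐ x ∂μ, f (g t x) = f x) : ∃ c : Y, ∀ᵐ x ∂μ, f x = c := by
  refine Filter.exists_eventuallyEq_const_of_forall_separating (l := ae μ) (f := f) IsOpen ?_
  intro U hU
  have hU' : ∀ t, g t ⁻¹' (f ⁻¹' U) =ᵐ[μ] f ⁻¹' U := fun t => by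
    filter_upwards [hinv t] with x hx
    exact propext (show f (g t x) ∈ U ↔ f x ∈ U by rw [hx])
  rcases herg (f ⁻¹' U) (hf U hU) hU' with h | h
  · exact Or.inr (measure_eq_zero_iff_ae_notMem.1 h)
  · exact Or.inl (by simpa using measure_eq_zero_iff_ae_notMem.1 h)

end Ergodicity

section HaarErgodicity

variable {S : Type*} [Group S] [TopologicalSpace S] [IsTopologicalGroup S]
  [LocallyCompactSpace S] [SecondCountableTopology S]
  [MeasurableSpace S] [BorelSpace S]

/-- If left translates of `F` by a dense set `D` meet `E` in null sets, then so do all left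
translates: for sets of finite measure, left translation is continuous in measure. -/
theorem measure_inter_preimage_mul_left_eq_zero {D : Set S} (hD : Dense D) {E F : Set S}
    (hF : MeasurableSet F)
    (h : ∀ s ∈ D, Measure.haar (E ∩ (fun x => s * x) ⁻¹' F) = 0) (s₀ : S) :
    Measure.haar (E ∩ (fun x => s₀ * x) ⁻¹' F) = 0 := by
  let μ : Measure S := Measure.haar
  let F' : ℕ → Set S := fun k => F ∩ spanningSets μ k
  have hF' : ⋃ k, F' k = F := by
    rw [← Set.inter_iUnion, iUnion_spanningSets, Set.inter_univ]
  -- Continuity in measure needs finite measure, so `F` is exhausted by the sets `F' k`.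
  rw [← hF', Set.preimage_iUnion, Set.inter_iUnion, measure_iUnion_null_iff]
  intro k
  have hFm : MeasurableSet (F' k) := hF.inter (measurableSet_spanningSets μ k)
  have hFfin : μ (F' k) ≠ ⊤ :=
    ((measure_mono Set.inter_subset_right).trans_lt (measure_spanningSets_lt_top μ k)).ne
  let f : S → C(S, S) := fun s => ⟨fun x => s * x, continuous_const_mul s⟩
  have hfc : Continuous f := ContinuousMap.continuous_of_continuous_uncurry _ continuous_mul
  have hmp : ∀ s, MeasurePreserving (f s) μ μ := fun s => measurePreserving_mul_left μ s
  have hlim := tendsto_measure_symmDiff_preimage_nhds_zero (hfc.tendsto s₀)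
    (Eventually.of_forall hmp) (hmp s₀) hFm.nullMeasurableSet hFfin
  by_contra hne
  obtain ⟨s, hs, hsD⟩ := hD.inter_nhds_nonempty
    (hlim.eventually (gt_mem_nhds (pos_iff_ne_zero.2 hne)))
  have hlt : μ (symmDiff (f s ⁻¹' F' k) (f s₀ ⁻¹' F' k)) < μ (E ∩ f s₀ ⁻¹' F' k) := hsD
  refine absurd hlt (not_lt.2 ?_)
  have hsub : E ∩ f s₀ ⁻¹' F' k ⊆
      (E ∩ f s ⁻¹' F) ∪ symmDiff (f s ⁻¹' F' k) (f s₀ ⁻¹' F' k) := by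
    rintro x ⟨hxE, hx⟩
    by_cases hxs : x ∈ f s ⁻¹' F' k
    · exact Or.inl ⟨hxE, hxs.1⟩
    · exact Or.inr (Or.inr ⟨hx, hxs⟩)
  calc μ (E ∩ f s₀ ⁻¹' F' k) ≤ _ := measure_mono hsub
    _ ≤ _ := measure_union_le _ _
    _ = _ := by rw [show μ (E ∩ f s ⁻¹' F) = 0 from h s hs, zero_add]

/-- A dense set of left translations is ergodic for Haar measure. -/
theorem haar_null_or_conull_of_dense_mul_left {D : Set S} (hD : Dense D) {E : Set S}
    (hE : MeasurableSet E)
    (h : ∀ s ∈ D, (fun x => s * x) ⁻¹' E =ᵐ[Measure.haar] E) :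
    (Measure.haar : Measure S) E = 0 ∨ (Measure.haar : Measure S) Eᶜ = 0 := by
  have key : ∀ s : S, (fun x => s • x) ⁻¹' E =ᵐ[(Measure.haar : Measure S)] E := by
    intro s
    have h1 := measure_inter_preimage_mul_left_eq_zero hD hE.compl (fun t ht => by
      have := (ae_eq_set.1 (h t ht)).2
      simpa [Set.sdiff_eq] using this) s
    have h2 := measure_inter_preimage_mul_left_eq_zero hD hE (fun t ht => by
      have := (ae_eq_set.1 (h t ht)).1
      rwa [Set.sdiff_eq, Set.inter_comm] at this) s
    refine ae_eq_set.2 ⟨?_, ?_⟩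
    · rwa [Set.sdiff_eq, Set.inter_comm]
    · simpa [Set.sdiff_eq] using h1
  have := ErgodicSMul.aeconst_of_forall_preimage_smul_ae_eq (G := S) hE key
  rcases eventuallyConst_set.1 this with h | h
  · exact Or.inr (measure_eq_zero_iff_ae_notMem.2 (by simpa using h))
  · exact Or.inl (measure_eq_zero_iff_ae_notMem.2 h)

open scoped Pointwise in
/-- A dense subgroup of right translations is ergodic for Haar measure: inversion preserves the
measure class and exchanges left and right translations. -/
theorem haar_null_or_conull_of_dense_mul_right {D : Subgroup S} (hD : Dense (D : Set S))
    {E : Set S} (hE : MeasurableSet E)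
    (h : ∀ s : D, (fun x => x * (s : S)) ⁻¹' E =ᵐ[Measure.haar] E) :
    (Measure.haar : Measure S) E = 0 ∨ (Measure.haar : Measure S) Eᶜ = 0 := by
  have hinv : ∀ s ∈ (D : Set S),
      (fun x => s * x) ⁻¹' E⁻¹ =ᵐ[(Measure.haar : Measure S)] (E⁻¹ : Set S) := by
    intro s hs
    have := (quasiMeasurePreserving_inv (Measure.haar : Measure S)).preimage_ae_eq
      (h ⟨s⁻¹, D.inv_mem hs⟩)
    have hset : (fun x => s * x) ⁻¹' E⁻¹ = Inv.inv ⁻¹' ((fun x => x * s⁻¹) ⁻¹' E) := by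
      ext x
      simp
    rw [hset]
    exact this
  have := haar_null_or_conull_of_dense_mul_left hD hE.inv hinv
  rwa [measure_inv_null, ← Set.compl_inv, measure_inv_null] at this

end HaarErgodicity

/-! ### The measure class on the coset space -/

section CosetSpace

variable {S : Type*} [Group S] [TopologicalSpace S] [IsTopologicalGroup S]
  [LocallyCompactSpace S] [MeasurableSpace S] [BorelSpace S]

theorem quasiMeasurePreserving_smul_cosetHaar (Γ : Subgroup S) (s : S) :
    Measure.QuasiMeasurePreserving (fun x : S ⧸ Γ => s • x) (cosetHaar Γ) (cosetHaar Γ) := by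
  have hm : Measurable (fun x : S ⧸ Γ => s • x) := measurable_from_quotient.2
    (QuotientGroup.measurable_coe.comp (measurable_const_mul s))
  refine ⟨hm, Measure.AbsolutelyContinuous.mk fun A hA h0 => ?_⟩
  rw [Measure.map_apply hm hA]
  rw [cosetHaar, Measure.map_apply QuotientGroup.measurable_coe hA] at h0
  rw [cosetHaar, Measure.map_apply QuotientGroup.measurable_coe (hm hA)]
  have hs := measurePreserving_mul_left (Measure.haar : Measure S) s
  have h1 := hs.quasiMeasurePreserving.preimage_null h0
  exact h1

end CosetSpace

/-! ### Proper actions and quotients by compact stabilizers -/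

section ProperOrbit

variable {B V : Type*} [Group B] [TopologicalSpace B] [TopologicalSpace V] [MulAction B V]
  [ProperSMul B V]

theorem isProperMap_smul_const [T1Space V] (v : V) : IsProperMap (fun b : B => b • v) := by
  have hcl : IsClosedEmbedding (fun b : B => (b, v)) := by
    refine ⟨isEmbedding_prodMkLeft v, ?_⟩
    have : Set.range (fun b : B => (b, v)) = Set.univ ×ˢ {v} := by
      ext ⟨b, w⟩; simp [eq_comm]
    rw [this]
    exact isClosed_univ.prod isClosed_singleton
  have h := (ProperSMul.isProperMap_smul_pair (G := B) (X := V)).comp hcl.isProperMap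
  exact isProperMap_of_comp_of_inj (g := fun w : V => (w, v))
    (continuous_id.smul continuous_const) (by fun_prop) h fun a b hab => (Prod.ext_iff.1 hab).1

/-- For a proper action, an orbit is closed and homeomorphic to the quotient by the stabilizer. -/
theorem isClosedEmbedding_ofQuotientStabilizer [T1Space V] (v : V) :
    IsClosedEmbedding (MulAction.ofQuotientStabilizer B v) := by
  have hp := isProperMap_smul_const (B := B) v
  refine .of_continuous_injective_isClosedMap ?_
    (MulAction.injective_ofQuotientStabilizer B v) ?_
  · exact hp.continuous.quotient_lift _
  · intro C hC
    have : MulAction.ofQuotientStabilizer B v '' C =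
        (fun b : B => b • v) '' ((fun b : B => (b : B ⧸ MulAction.stabilizer B v)) ⁻¹' C) := by
      ext w
      constructor
      · rintro ⟨q, hq, rfl⟩
        obtain ⟨b, rfl⟩ := QuotientGroup.mk_surjective q
        exact ⟨b, hq, rfl⟩
      · rintro ⟨b, hb, rfl⟩
        exact ⟨b, hb, rfl⟩
    rw [this]
    exact hp.isClosedMap _ (hC.preimage continuous_quot_mk)

/-- The orbit space of a proper action is Hausdorff, so under ergodicity a map that moves only along
orbits takes almost all its values in one orbit. -/
theorem exists_ae_mem_orbit [SecondCountableTopology V] [MeasurableSpace V] [BorelSpace V]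
    [Nonempty V] {X ι : Type*} [MeasurableSpace X] {μ : Measure X} (g : ι → X → X)
    (herg : ∀ E : Set X, MeasurableSet E → (∀ t, g t ⁻¹' E =ᵐ[μ] E) → μ E = 0 ∨ μ Eᶜ = 0)
    {φ : X → V} (hφ : Measurable φ)
    (h : ∀ t, ∀ᵐ x ∂μ, φ (g t x) ∈ MulAction.orbit B (φ x)) :
    ∃ v : V, ∀ᵐ x ∂μ, φ x ∈ MulAction.orbit B v := by
  have : SecondCountableTopology (Quotient (MulAction.orbitRel B V)) :=
    ContinuousConstSMul.secondCountableTopology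
  have : Nonempty (Quotient (MulAction.orbitRel B V)) := Nonempty.map (Quotient.mk _) ‹_›
  have hc : Continuous (Quotient.mk (MulAction.orbitRel B V)) := continuous_quot_mk
  obtain ⟨q, hq⟩ := exists_ae_eq_const_of_invariant g herg
    (f := fun x => Quotient.mk (MulAction.orbitRel B V) (φ x))
    (fun U hU => hφ (hU.preimage hc).measurableSet)
    (fun t => (h t).mono fun x hx => Quotient.sound hx)
  obtain ⟨v, rfl⟩ := Quotient.exists_rep q
  exact ⟨v, hq.mono fun x hx => Quotient.exact hx⟩

end ProperOrbit

/-! ### Maps to an abelian group that transform by translations -/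

section QuasiEquivariant

open scoped commutatorElement

variable {A : Type*} [Group A] [TopologicalSpace A] [IsTopologicalGroup A] [T2Space A]
  [SecondCountableTopology A] [MeasurableSpace A] [BorelSpace A]

/-- If an ergodic family of transformations multiplies `φ` on the left by constants, then every
nonsingular transformation `s` commuting with the family multiplies `φ` on the right by a constant,
because `x ↦ (φ x)⁻¹ * φ (s x)` is invariant. -/
theorem exists_ae_eq_mul_const_of_commute {X ι : Type*} [MeasurableSpace X] {μ : Measure X}
    (g : ι → X → X)
    (herg : ∀ E : Set X, MeasurableSet E → (∀ t, g t ⁻¹' E =ᵐ[μ] E) → μ E = 0 ∨ μ Eᶜ = 0)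
    {φ : X → A} (hφ : Measurable φ) (h : ∀ t, ∃ a : A, ∀ᵐ x ∂μ, φ (g t x) = a * φ x)
    {s : X → X} (hs : Measure.QuasiMeasurePreserving s μ μ) (hcomm : ∀ t x, s (g t x) = g t (s x)) :
    ∃ c : A, ∀ᵐ x ∂μ, φ (s x) = φ x * c := by
  have hf : Measurable fun x => (φ x)⁻¹ * φ (s x) := hφ.inv.mul (hφ.comp hs.measurable)
  obtain ⟨c, hc⟩ := exists_ae_eq_const_of_invariant g herg
    (f := fun x => (φ x)⁻¹ * φ (s x)) (fun U hU => hf hU.measurableSet) fun t => by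
      obtain ⟨a, ha⟩ := h t
      filter_upwards [ha, hs.ae ha] with x hx hsx
      rw [hcomm, hx, hsx]
      group
  exact ⟨c, hc.mono fun x hx => by rw [← hx, mul_inv_cancel_left]⟩

variable {S : Type*} [Group S] [TopologicalSpace S] [IsTopologicalGroup S]

/-- If `S ⧸ closedNormalClosure Γ` has trivial topological abelianization, then a homomorphism from
`S` to an abelian group that is trivial on `Γ` has dense kernel. -/
theorem dense_ker_of_subsingleton_topologicalAbelianization {A : Type*} [Group A]
    (hA : ∀ a b : A, a * b = b * a) (Γ : Subgroup S)
    (hab : Subsingleton (TopologicalAbelianization (S ⧸ closedNormalClosure Γ)))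
    (d : S →* A) (hd : ∀ γ ∈ Γ, d γ = 1) : Dense (d.ker : Set S) := by
  let N := closedNormalClosure Γ
  let C : Subgroup S := d.ker.topologicalClosure
  have hNC : N ≤ C :=
    Subgroup.topologicalClosure_mono (Subgroup.normalClosure_le_normal fun γ hγ => hd γ hγ)
  let π : S →* S ⧸ N := QuotientGroup.mk' N
  -- `C` is closed and saturated, so its image in the quotient is closed.
  have hsat : ∀ s, π s ∈ C.map π ↔ s ∈ C := by
    intro s
    refine ⟨?_, fun hs => ⟨s, hs, rfl⟩⟩
    rintro ⟨c, hc, hcs⟩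
    have : c⁻¹ * s ∈ N := QuotientGroup.eq.1 hcs
    simpa using C.mul_mem hc (hNC this)
  have hclosed : IsClosed ((C.map π : Subgroup (S ⧸ N)) : Set (S ⧸ N)) := by
    rw [← QuotientGroup.isOpenQuotientMap_mk.isQuotientMap.isClosed_preimage]
    convert! d.ker.isClosed_topologicalClosure using 1
    ext s
    exact hsat s
  have hcomm : commutator (S ⧸ N) ≤ C.map π := by
    rw [commutator_def, Subgroup.commutator_le]
    rintro x - y -
    obtain ⟨a, rfl⟩ := QuotientGroup.mk'_surjective N x
    obtain ⟨b, rfl⟩ := QuotientGroup.mk'_surjective N y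
    rw [← map_commutatorElement]
    refine ⟨⁅a, b⁆, Subgroup.le_topologicalClosure _ ?_, rfl⟩
    rw [MonoidHom.mem_ker, map_commutatorElement, commutatorElement_eq_one_iff_mul_comm]
    exact hA _ _
  have htop : (commutator (S ⧸ N)).topologicalClosure = ⊤ :=
    QuotientGroup.subgroup_eq_top_of_subsingleton _ hab
  have hle : (⊤ : Subgroup (S ⧸ N)) ≤ C.map π :=
    htop ▸ Subgroup.topologicalClosure_minimal _ hcomm hclosed
  exact fun s => (hsat s).1 (hle (Subgroup.mem_top _))

variable [LocallyCompactSpace S] [MeasurableSpace S] [BorelSpace S]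

/-- The elements of `S` acting on `φ : S → A` by left multiplication by a constant. -/
def leftQuasiStabilizer (φ : S → A) : Subgroup S where
  carrier := {s | ∃ a : A, ∀ᵐ x ∂(Measure.haar : Measure S), φ (s * x) = a * φ x}
  one_mem' := ⟨1, by simp⟩
  mul_mem' := by
    rintro s t ⟨a, ha⟩ ⟨b, hb⟩
    refine ⟨a * b, ?_⟩
    filter_upwards [hb,
      (measurePreserving_mul_left Measure.haar t).quasiMeasurePreserving.ae ha] with x hx htx
    rw [mul_assoc, htx, hx, mul_assoc]
  inv_mem' := by
    rintro s ⟨a, ha⟩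
    refine ⟨a⁻¹, ?_⟩
    filter_upwards [(measurePreserving_mul_left Measure.haar s⁻¹).quasiMeasurePreserving.ae ha]
      with x hx
    rw [eq_inv_mul_iff_mul_eq, ← hx, mul_inv_cancel_left]

/-- A map `φ : S → A` to an abelian group that is right `Γ`-invariant and is multiplied by
constants under a dense subgroup of left translations is essentially constant. Right translations
commute with left ones, so by ergodicity `φ (x * y) = φ x * d y`; here `d : S → A` is a homomorphism
trivial on `Γ`, so its kernel is dense, and `φ` is right invariant under this kernel. -/
theorem ae_eq_const_of_dense_leftQuasiStabilizer [SecondCountableTopology S]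
    (hA : ∀ a b : A, a * b = b * a) (Γ : Subgroup S)
    (hab : Subsingleton (TopologicalAbelianization (S ⧸ closedNormalClosure Γ)))
    {φ : S → A} (hφ : Measurable φ) (hφΓ : ∀ x, ∀ γ ∈ Γ, φ (x * γ) = φ x)
    (hdense : Dense (leftQuasiStabilizer φ : Set S)) :
    ∃ c : A, ∀ᵐ x ∂(Measure.haar : Measure S), φ x = c := by
  have hex : ∀ y : S, ∃ c : A, ∀ᵐ x ∂(Measure.haar : Measure S), φ (x * y) = φ x * c := fun y =>
    exists_ae_eq_mul_const_of_commute
      (fun (s : leftQuasiStabilizer φ) (x : S) => (s : S) * x)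
      (fun E hE h => haar_null_or_conull_of_dense_mul_left hdense hE fun s hs => h ⟨s, hs⟩)
      hφ (fun s => s.2) (quasiMeasurePreserving_mul_right Measure.haar y)
      (fun s x => mul_assoc _ _ _)
  choose d hd using hex
  have huniq : ∀ {y : S} {c : A},
      (∀ᵐ x ∂(Measure.haar : Measure S), φ (x * y) = φ x * c) → d y = c := by
    intro y c hc
    obtain ⟨x, hx, hx'⟩ := ((hd y).and hc).exists
    exact mul_left_cancel (hx.symm.trans hx')
  let δ : S →* A := MonoidHom.mk' d fun y z => huniq <| by
    filter_upwards [hd y, (quasiMeasurePreserving_mul_right Measure.haar y).ae (hd z)] with x hy hz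
    rw [← mul_assoc, hz, hy, mul_assoc]
  have hker : Dense (δ.ker : Set S) :=
    dense_ker_of_subsingleton_topologicalAbelianization hA Γ hab δ fun γ hγ =>
      huniq (Eventually.of_forall fun x => by rw [hφΓ x γ hγ, mul_one])
  refine exists_ae_eq_const_of_invariant (fun (s : δ.ker) (x : S) => x * (s : S))
    (fun E hE h => haar_null_or_conull_of_dense_mul_right hker hE h)
    (fun U hU => hφ hU.measurableSet) fun s => ?_
  filter_upwards [hd s] with x hx
  have hs : d s = 1 := s.2
  rw [hx, hs, mul_one]

end QuasiEquivariant

/-! ### Propagation along the sequence of commuting subgroups -/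

section Propagation

variable {S : Type*} [Group S] [TopologicalSpace S] [IsTopologicalGroup S]
  [LocallyCompactSpace S] [SecondCountableTopology S] [MeasurableSpace S] [BorelSpace S]
  {A : Type*} [Group A] [TopologicalSpace A] [IsTopologicalGroup A] [T2Space A]
  [SecondCountableTopology A] [MeasurableSpace A] [BorelSpace A]

/-- A map from `S ⧸ Γ` to an abelian group that is multiplied by constants under one of the `T i`
is multiplied by constants under its neighbours, hence under all of them, hence under a dense
subgroup of `S`. -/
theorem ae_eq_const_of_forall_mem_exists_ae_eq_mul
    (Γ : Subgroup S) (n : ℕ∞) (T : ℕ → Subgroup S)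
    (hgen : (⨆ (i : ℕ) (_ : (i : ℕ∞) < n), T i).topologicalClosure = ⊤)
    (hcomm : ∀ i : ℕ, ((i + 1 : ℕ) : ℕ∞) < n → ∀ a ∈ T i, ∀ b ∈ T (i + 1), a * b = b * a)
    (herg : ∀ i : ℕ, (i : ℕ∞) < n → IsErgodicAction (T i) (cosetHaar Γ))
    (hab : Subsingleton (TopologicalAbelianization (S ⧸ closedNormalClosure Γ)))
    (hA : ∀ a b : A, a * b = b * a) {φ : S ⧸ Γ → A} (hφ : Measurable φ) {i : ℕ} (hi : (i : ℕ∞) < n)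
    (h : ∀ t ∈ T i, ∃ a : A, ∀ᵐ x ∂cosetHaar Γ, φ (t • x) = a * φ x) :
    ∃ c : A, ∀ᵐ x ∂cosetHaar Γ, φ x = c := by
  let P : ℕ → Prop := fun j => ∀ t ∈ T j, ∃ a : A, ∀ᵐ x ∂cosetHaar Γ, φ (t • x) = a * φ x
  have step : ∀ j k : ℕ, (j : ℕ∞) < n → (∀ a ∈ T j, ∀ b ∈ T k, a * b = b * a) → P j → P k := by
    intro j k hj hjk hP s hs
    obtain ⟨c, hc⟩ := exists_ae_eq_mul_const_of_commute
      (fun (t : T j) (x : S ⧸ Γ) => t • x) (herg j hj) hφ (fun t => hP t t.2)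
      (quasiMeasurePreserving_smul_cosetHaar Γ s) fun t x => by
        change s • (t : S) • x = (t : S) • s • x
        rw [smul_smul, smul_smul, hjk t t.2 s hs]
    exact ⟨c, hc.mono fun x hx => hx.trans (hA _ _)⟩
  have mono : ∀ {j k : ℕ}, j ≤ k → (k : ℕ∞) < n → (j : ℕ∞) < n := fun hjk hk =>
    (Nat.cast_le.2 hjk).trans_lt hk
  have up : ∀ j, i ≤ j → (j : ℕ∞) < n → P j := by
    intro j hij
    induction j, hij using Nat.le_induction with
    | base => exact fun _ => h
    | succ j _ ih =>
      intro hj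
      have hj' := mono (Nat.le_succ j) hj
      exact step j (j + 1) hj' (hcomm j hj) (ih hj')
  have down : ∀ j, j ≤ i → P j := by
    intro j hji
    induction hji using Nat.decreasingInduction with
    | self => exact h
    | of_succ j hj ih =>
      have hj' := mono (show j + 1 ≤ i from hj) hi
      exact step (j + 1) j hj' (fun a ha b hb => (hcomm j hj' b hb a ha).symm) ih
  have hall : ∀ j : ℕ, (j : ℕ∞) < n → P j := fun j hj =>
    (le_total i j).elim (fun hij => up j hij hj) (fun hji => down j hji)
  let Φ : S → A := fun x => φ (x : S ⧸ Γ)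
  have hΦ : Measurable Φ := hφ.comp QuotientGroup.measurable_coe
  have hle : (⨆ (j : ℕ) (_ : (j : ℕ∞) < n), T j) ≤ leftQuasiStabilizer Φ := by
    refine iSup₂_le fun j hj t ht => ?_
    obtain ⟨a, ha⟩ := hall j hj t ht
    exact ⟨a, ae_of_ae_map QuotientGroup.measurable_coe.aemeasurable ha⟩
  have hdense : Dense (leftQuasiStabilizer Φ : Set S) := fun s =>
    (Subgroup.topologicalClosure_mono hle) (hgen ▸ Subgroup.mem_top s)
  obtain ⟨c, hc⟩ := ae_eq_const_of_dense_leftQuasiStabilizer hA Γ hab hΦ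
    (fun x γ hγ => congrArg φ (QuotientGroup.mk_mul_of_mem x hγ)) hdense
  exact ⟨c, (ae_map_iff QuotientGroup.measurable_coe.aemeasurable
    (hφ (measurableSet_singleton c))).2 hc⟩

end Propagation

/-! ### Proper representations -/

theorem mainTheorem2 {S : Type u} [Group S] [TopologicalSpace S] [IsTopologicalGroup S]
    [LocallyCompactSpace S] [SecondCountableTopology S] [T2Space S]
    [MeasurableSpace S] [BorelSpace S]
    (Γ : Subgroup S) (hΓ : IsClosed (Γ : Set S))
    -- the sequence is `T i` for `i < n`; it is infinite when `n = ⊤`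
    (n : ℕ∞) (T : ℕ → Subgroup S)
    (hgen : (⨆ (i : ℕ) (_ : (i : ℕ∞) < n), T i).topologicalClosure = ⊤)
    (habel : ∀ i : ℕ, (i : ℕ∞) < n → ∀ a ∈ T i, ∀ b ∈ T i, a * b = b * a)
    (hcomm : ∀ i : ℕ, ((i + 1 : ℕ) : ℕ∞) < n → ∀ a ∈ T i, ∀ b ∈ T (i + 1), a * b = b * a)
    (herg : ∀ i : ℕ, (i : ℕ∞) < n → IsErgodicAction (T i) (cosetHaar Γ))
    (hab : Subsingleton (TopologicalAbelianization (S ⧸ closedNormalClosure Γ))) :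
    ∀ i : ℕ, (i : ℕ∞) < n →
      OnlyTrivialProperReps.{u, v, w} (T i) (cosetHaar Γ) := by
  intro i hi G _ _ _ _ θ _ V _ _ _ _ _ _ φ₀ hφ₀ heq₀
  let μ := cosetHaar Γ
  obtain ⟨φ, hφ, hφφ₀⟩ : ∃ φ : S ⧸ Γ → V, Measurable φ ∧ φ₀ =ᵐ[μ] φ :=
    ⟨hφ₀.mk φ₀, hφ₀.measurable_mk, hφ₀.ae_eq_mk⟩
  suffices ∃ v : V, ∀ᵐ x ∂μ, φ x = v by
    obtain ⟨v, hv⟩ := this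
    exact ⟨v, by filter_upwards [hφφ₀, hv] with x h1 h2 using h1.trans h2⟩
  have heq : ∀ t : T i, ∀ᵐ x ∂μ, φ (t • x) = θ t • φ x := by
    intro t
    filter_upwards [heq₀ t, hφφ₀,
      (quasiMeasurePreserving_smul_cosetHaar Γ (t : S)).ae hφφ₀] with x h1 h2 h3
    rw [← h2, ← h1]
    exact h3.symm
  -- The closure `B` of `θ (T i)` is an abelian group acting properly on `V`.
  let B : Subgroup G := θ.range.topologicalClosure
  have : IsClosed (B : Set G) := θ.range.isClosed_topologicalClosure
  have hB : ∀ a b : B, a * b = b * a := by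
    refine (θ.range.commGroupTopologicalClosure ?_).mul_comm
    rintro ⟨_, a, rfl⟩ ⟨_, b, rfl⟩
    refine Subtype.ext ?_
    have : a * b = b * a := Subtype.ext (habel i hi a a.2 b b.2)
    simp only [Subgroup.coe_mul, ← map_mul, this]
  have hθB : ∀ t, θ t ∈ B := fun t => θ.range.le_topologicalClosure ⟨t, rfl⟩
  have : Nonempty V := ⟨φ (1 : S)⟩
  obtain ⟨v, hv⟩ := exists_ae_mem_orbit (B := B) (fun (t : T i) (x : S ⧸ Γ) => t • x) (herg i hi)
    hφ fun t => (heq t).mono fun x hx => ⟨⟨θ t, hθB t⟩, hx.symm⟩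
  -- The orbit of `v` is homeomorphic to the abelian group `B ⧸ stabilizer B v`.
  let K : Subgroup B := MulAction.stabilizer B v
  have : K.Normal := ⟨fun k hk b => by rwa [hB b k, mul_inv_cancel_right]⟩
  have he := isClosedEmbedding_ofQuotientStabilizer (B := B) v
  let e : B ⧸ K → V := MulAction.ofQuotientStabilizer B v
  have : T2Space (B ⧸ K) := he.isEmbedding.t2Space
  have : SecondCountableTopology (B ⧸ K) := he.isEmbedding.secondCountableTopology
  let _ : MeasurableSpace (B ⧸ K) := borel _
  have : BorelSpace (B ⧸ K) := ⟨rfl⟩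
  -- `r` is a Borel inverse of the embedding `e`, extended arbitrarily off the orbit.
  obtain ⟨r, hr, hre⟩ := he.measurableEmbedding.exists_measurable_extend
    (measurable_id (α := B ⧸ K)) fun _ => ⟨1⟩
  have hφe : ∀ᵐ x ∂μ, φ x = e (r (φ x)) := hv.mono fun x hx => by
    obtain ⟨b, hb⟩ := hx
    have hb' : φ x = e (b : B ⧸ K) := hb.symm
    rw [hb']
    exact congrArg e (congrFun hre _).symm
  have hA : ∀ a b : B ⧸ K, a * b = b * a := by
    intro a b
    obtain ⟨a, rfl⟩ := QuotientGroup.mk_surjective a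
    obtain ⟨b, rfl⟩ := QuotientGroup.mk_surjective b
    exact congrArg _ (hB a b)
  obtain ⟨c, hc⟩ := ae_eq_const_of_forall_mem_exists_ae_eq_mul Γ n T hgen hcomm herg hab hA
    (φ := fun x => r (φ x)) (hr.comp hφ) hi fun t ht => by
      let b : B := ⟨θ ⟨t, ht⟩, hθB _⟩
      refine ⟨(b : B ⧸ K), ?_⟩
      filter_upwards [heq ⟨t, ht⟩, hφe,
        (quasiMeasurePreserving_smul_cosetHaar Γ t).ae hφe] with x h1 h2 h3
      refine he.injective (h3.symm.trans (h1.trans ?_))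
      rw [h2]
      obtain ⟨b', hb'⟩ := QuotientGroup.mk_surjective (r (φ x))
      have hr' : r (e (b' : B ⧸ K)) = (b' : B ⧸ K) := congrFun hre _
      rw [← hb', hr']
      exact (mul_smul b b' v).symm
  exact ⟨e c, by filter_upwards [hφe, hc] with x h1 h2 using by rw [h1, h2]⟩
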